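/- Let $c\ge 0$ be an integer. For a group $H$ with a free presentation $1\to R\to F\to H\to 1$, let $\mathcal N_cM(H)=(R\cap\gamma_{c+1}(F))/[R,{}_cF]$, where $[R,{}_0F]=R$ and $[R,{}_{k+1}F]=[[R,{}_kF],F]$; up to isomorphism this does not depend on the presentation. An $\mathcal N_c$-covering group of $H$ is a group $H^*$ with a normal subgroup $A$ such that $H^*/A\cong H$, $A\subseteq Z_c(H^*)\cap\gamma_{c+1}(H^*)$ and $A\cong\mathcal N_cM(H)$. Here $\gamma_1(H^*)=H^*\supseteq\gamma_2(H^*)\supseteq\cdots$ and $Z_0(H^*)=1\subseteq Z_1(H^*)\subseteq\cdots$ are the lower and upper central series. Let $G$ be a torsion nilpotent group, and let $(p_i)_{i\in I}$ be a family of distinct primes that contains every prime which is the order of an element of $G$. For each $i\in I$ let $P_i$ be the Sylow $p_i$-subgroup of $G$ and let $P_i^*$ be an $\mathcal N_c$-covering group of $P_i$. Then the direct product $\prod^{\times}_{i\in I}P_i^*$, consisting of the tuples with only finitely many components different from $1$, is an $\mathcal N_c$-covering group of $G$. -/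

import Mathlib

/-- The iterated commutator subgroup `[R, _c F] = [⋯[[R, F], F], ⋯, F]` (`c` times). -/
def iteratedCommutator {F : Type*} [Group F] (R : Subgroup F) : ℕ → Subgroup F
  | 0 => R
  | c + 1 => ⁅iteratedCommutator R c, (⊤ : Subgroup F)⁆

instance iteratedCommutator_normal {F : Type*} [Group F] (R : Subgroup F) [R.Normal] (c : ℕ) :
    (iteratedCommutator R c).Normal := by
  induction c with
  | zero => exact ‹R.Normal›
  | succ c ih => exact Subgroup.commutator_normal _ _

/-- The kernel `R` of the canonical free presentation `1 → R → F → G → 1`, where `F` is the free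
group on the underlying set of `G`. -/
def presentationKernel (G : Type*) [Group G] : Subgroup (FreeGroup G) :=
  (FreeGroup.lift (id : G → G)).ker

instance presentationKernel_normal (G : Type*) [Group G] : (presentationKernel G).Normal :=
  MonoidHom.normal_ker _

/-- The subgroup `R ∩ γ_{c+1}(F)` for the canonical free presentation of `G`. Mathlib numbers the
lower central series from `0`, so that `γ_{c+1}` is its term of index `c`. -/
def multiplierNumerator (c : ℕ) (G : Type*) [Group G] : Subgroup (FreeGroup G) :=
  presentationKernel G ⊓ (⊤ : Subgroup (FreeGroup G)).lowerCentralSeries c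

/-- The `c`-nilpotent multiplier `N_c M(G) = (R ∩ γ_{c+1}(F)) / [R, _c F]`, that is, the Baer
invariant of `G` with respect to the variety of nilpotent groups of class at most `c`. -/
abbrev NilpotentMultiplier (c : ℕ) (G : Type*) [Group G] : Type _ :=
  multiplierNumerator c G ⧸
    (iteratedCommutator (presentationKernel G) c).subgroupOf (multiplierNumerator c G)

/-- `Gs` is an `N_c`-covering group of `G`: it has a normal subgroup `A` contained in
`Z_c(Gs) ∩ γ_{c+1}(Gs)` such that `Gs / A ≅ G` and `A ≅ N_c M(G)`. -/
def IsNilpotentCovering (c : ℕ) (G Gs : Type*) [Group G] [Group Gs] : Prop :=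
  ∃ (A : Subgroup Gs) (_ : A.Normal),
    A ≤ Subgroup.upperCentralSeries Gs c ⊓ (⊤ : Subgroup Gs).lowerCentralSeries c ∧
    Nonempty (Gs ⧸ A ≃* G) ∧
    Nonempty (A ≃* NilpotentMultiplier c G)

/-- The direct product `∏^× H i` of an arbitrary family of groups: the tuples with only finitely
many components different from `1`, with componentwise multiplication. -/
abbrev DirectProduct {ι : Type*} (H : ι → Type*) [∀ i, Group (H i)] : Type _ :=
  RestrictedProduct H (fun i => (⊥ : Subgroup (H i))) Filter.cofinite

/-! The crux is that $\mathcal N_cM(G)$ is the direct product of the $\mathcal N_cM(P_i)$. Granted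
this, the tuples with components in the given subgroups $A_i\subseteq P_i^*$ form the required
subgroup, since $G$ is the direct product of its Sylow subgroups.

The case $c=0$ is trivial. For $c\ge1$ let $E=F/[R,{}_cF]$ with $F$ free on $G$, let $\pi:E\to G$,
so that $\ker\pi\subseteq Z_c(E)$, and let $H_i$ be the image in $E$ of the free group on $P_i$.
Modulo $Z_{c-1}(E)$ the kernel is central, so for $x,y$ over distinct $P_i,P_j$ the commutator
$[x,y]$ is central and killed by two coprime exponents, hence trivial (`commutator_comap_le`). The
three subgroups lemma turns this into $[\gamma_c(H_i),H_j]=1$ and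
$\gamma_{c+1}(E)=\prod\gamma_{c+1}(H_i)$. The multiplier of $G$ is $\ker\pi\cap\gamma_{c+1}(E)$. Its
elements factor accordingly, and uniqueness of components in $G$ puts each factor over $1$
(`liftSubtype_surjective`). Functoriality along the projections $G\to P_i$ gives injectivity
(`liftSubtype_injective`). -/

namespace DirectProduct

/-! ### Restricted direct products -/

variable {ι : Type*} {H K : ι → Type*} [∀ i, Group (H i)] [∀ i, Group (K i)]
variable {G : Type*} [Group G]

theorem finite_support (x : DirectProduct H) : {i | x i ≠ 1}.Finite := by
  have h := x.eventually
  simpa [Filter.eventually_cofinite] using h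

/-- The finite set of the indices of the components different from `1`. -/
noncomputable def support (x : DirectProduct H) : Finset ι := x.finite_support.toFinset

theorem notMem_support {x : DirectProduct H} {i : ι} : i ∉ support x ↔ x i = 1 := by
  simp [support]

/-- The homomorphism between direct products that is given by homomorphisms of the factors. -/
def map (φ : ∀ i, H i →* K i) : DirectProduct H →* DirectProduct K :=
  RestrictedProduct.mapAlongMonoidHom H K id Filter.tendsto_id φ
    (Filter.Eventually.of_forall fun i x hx => by
      have hx : x = 1 := by simpa using hx
      simp [hx])

@[simp]
theorem map_apply (φ : ∀ i, H i →* K i) (x : DirectProduct H) (i : ι) :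
    map φ x i = φ i (x i) := rfl

theorem map_injective {φ : ∀ i, H i →* K i} (hφ : ∀ i, Function.Injective (φ i)) :
    Function.Injective (map φ) := fun x y hxy =>
  RestrictedProduct.ext _ _ fun i => hφ i (by rw [← map_apply, hxy, map_apply])

theorem mem_ker_map {φ : ∀ i, H i →* K i} {x : DirectProduct H} :
    x ∈ (map φ).ker ↔ ∀ i, x i ∈ (φ i).ker := by
  simp only [MonoidHom.mem_ker, RestrictedProduct.ext_iff, map_apply,
    RestrictedProduct.one_apply]

theorem mem_range_map {φ : ∀ i, H i →* K i} {y : DirectProduct K} :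
    y ∈ (map φ).range ↔ ∀ i, y i ∈ (φ i).range := by
  classical
  constructor
  · rintro ⟨x, rfl⟩ i
    exact ⟨x i, rfl⟩
  · intro h
    choose x hx using h
    -- A chosen preimage of `1` need not be `1`; resetting it keeps the support finite.
    have hy : ∀ᶠ i in Filter.cofinite, (if y i = 1 then 1 else x i) ∈ (⊥ : Subgroup (H i)) :=
      y.eventually.mono fun i hi => by
        have hi : y i = 1 := by simpa using hi
        simp [hi]
    refine ⟨⟨fun i => if y i = 1 then 1 else x i, hy⟩, RestrictedProduct.ext _ _ fun i => ?_⟩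
    change φ i (if y i = 1 then 1 else x i) = y i
    split_ifs with h
    · rw [map_one, h]
    · exact hx i

theorem map_surjective {φ : ∀ i, H i →* K i} (hφ : ∀ i, Function.Surjective (φ i)) :
    Function.Surjective (map φ) := fun y => mem_range_map.2 fun i => hφ i (y i)

section

variable [DecidableEq ι]

/-- The inclusion of a factor into the direct product. -/
def single (i : ι) : H i →* DirectProduct H where
  toFun := RestrictedProduct.mulSingle (fun i => (⊥ : Subgroup (H i))) i
  map_one' := RestrictedProduct.mulSingle_one _ i
  map_mul' := RestrictedProduct.mulSingle_mul _ i

@[simp]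
theorem single_same (i : ι) (x : H i) : single i x i = x :=
  RestrictedProduct.mulSingle_eq_same _ i x

theorem single_of_ne {i j : ι} (h : j ≠ i) (x : H i) : single i x j = 1 :=
  RestrictedProduct.mulSingle_eq_of_ne _ x h

theorem commute_single {i j : ι} (h : i ≠ j) (x : H i) (y : H j) :
    Commute (single i x : DirectProduct H) (single j y) := by
  refine RestrictedProduct.ext _ _ fun k => ?_
  simp only [RestrictedProduct.mul_apply]
  by_cases hk : k = i
  · subst hk
    simp [single_of_ne h]
  · simp [single_of_ne hk]

theorem map_single (φ : ∀ i, H i →* K i) (i : ι) (x : H i) :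
    map φ (single i x) = single i (φ i x) := by
  refine RestrictedProduct.ext _ _ fun j => ?_
  rw [map_apply]
  by_cases hj : j = i
  · subst hj
    rw [single_same, single_same]
  · rw [single_of_ne hj, single_of_ne hj, map_one]

end

@[elab_as_elim]
theorem induction_on [DecidableEq ι] {C : DirectProduct H → Prop} (x : DirectProduct H)
    (one : C 1) (mul_single : ∀ (i : ι) (a : H i) (y : DirectProduct H), C y → C (single i a * y)) :
    C x := by
  suffices ∀ (s : Finset ι) (x : DirectProduct H), (∀ i, i ∉ s → x i = 1) → C x from
    this (support x) x fun i => notMem_support.1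
  intro s
  induction s using Finset.induction_on with
  | empty =>
    intro x hx
    rwa [show x = 1 from RestrictedProduct.ext _ _ fun i => hx i (Finset.notMem_empty i)]
  | insert i s his ih =>
    intro x hx
    have := mul_single i (x i) (single i (x i)⁻¹ * x) (ih _ fun j hj => by
      by_cases hji : j = i
      · subst hji
        simp
      · simp [single_of_ne hji, hx j (by simp [hji, hj])])
    simpa using this

theorem hom_ext [DecidableEq ι] {f g : DirectProduct H →* G}
    (h : ∀ i x, f (single i x) = g (single i x)) : f = g := by
  ext x
  induction x using induction_on with
  | one => simp
  | mul_single i a y hy => simp [h, hy]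

section lift

variable (φ : ∀ i, H i →* G) (hφ : ∀ i j, i ≠ j → ∀ x y, Commute (φ i x) (φ j y))

theorem noncommProd_eq_of_subset {s t : Finset ι} (hst : s ⊆ t) (f : ι → G)
    (hs : (s : Set ι).Pairwise (Function.onFun Commute f))
    (ht : (t : Set ι).Pairwise (Function.onFun Commute f)) (h : ∀ i ∈ t, i ∉ s → f i = 1) :
    t.noncommProd f ht = s.noncommProd f hs := by
  classical
  have hd : Disjoint s (t \ s) := Finset.disjoint_sdiff
  have ht' : t = s ∪ (t \ s) := (Finset.union_sdiff_of_subset hst).symm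
  have hc : ((s ∪ (t \ s) : Finset ι) : Set ι).Pairwise (Function.onFun Commute f) := by
    rwa [← ht']
  rw [Finset.noncommProd_congr ht' (fun _ _ => rfl) ht,
    Finset.noncommProd_union_of_disjoint hd f hc,
    Finset.noncommProd_eq_pow_card (t \ s) f _ 1 fun i hi => by
      rw [Finset.mem_sdiff] at hi
      exact h i hi.1 hi.2]
  simp

/-- The homomorphism from a direct product that is given by homomorphisms of the factors with
commuting images. -/
noncomputable def lift : DirectProduct H →* G where
  toFun x := (support x).noncommProd (fun i => φ i (x i)) fun i _ j _ hij => hφ i j hij _ _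
  map_one' := by
    have : support (1 : DirectProduct H) = ∅ := by
      ext i
      simpa using notMem_support.2 (rfl : (1 : DirectProduct H) i = 1)
    refine (Finset.noncommProd_congr this (fun _ _ => rfl) _).trans ?_
    simp
  map_mul' x y := by
    classical
    have hs (z : DirectProduct H) (hz : support z ⊆ support x ∪ support y ∪ support (x * y)) :=
      noncommProd_eq_of_subset hz (fun i => φ i (z i)) (fun i _ j _ hij => hφ i j hij _ _)
        (fun i _ j _ hij => hφ i j hij _ _)
        (fun i _ hi => by simp [notMem_support.1 hi])
    refine (hs (x * y) (by grind)).symm.trans (Eq.trans ?_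
      (congrArg₂ (· * ·) (hs x (by grind)) (hs y (by grind))))
    refine Eq.trans ?_ (Finset.noncommProd_mul_distrib (fun i => φ i (x i)) (fun i => φ i (y i))
      (fun i _ j _ hij => hφ i j hij _ _) (fun i _ j _ hij => hφ i j hij _ _)
      (fun i _ j _ hij => hφ i j hij _ _))
    exact Finset.noncommProd_congr rfl (fun i _ => by simp) _

@[simp]
theorem lift_single [DecidableEq ι] (i : ι) (x : H i) : lift φ hφ (single i x) = φ i x := by
  have hs : support (single i x) ⊆ {i} := fun j hj => by
    by_contra hji
    exact (not_imp_not.2 notMem_support.2) (not_not.2 hj) (single_of_ne (by simpa using hji) x)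
  refine (noncommProd_eq_of_subset hs (fun j => φ j (single i x j))
    (fun i _ j _ hij => hφ i j hij _ _) (fun i _ j _ hij => hφ i j hij _ _)
    (fun i _ hi => by simp [notMem_support.1 hi])).symm.trans ?_
  simp

theorem lift_mem {S : Subgroup G} {x : DirectProduct H} (hx : ∀ i, φ i (x i) ∈ S) :
    lift φ hφ x ∈ S :=
  S.noncommProd_mem (fun i _ j _ hij => hφ i j hij _ _) fun i _ => hx i

end lift

theorem mem_of_forall_single_mem [DecidableEq ι] {S : Subgroup (DirectProduct H)}
    {x : DirectProduct H} (hx : ∀ i, single i (x i) ∈ S) : x ∈ S := by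
  have h : lift (fun i => single i) (fun i j hij x y => commute_single hij x y) =
      MonoidHom.id (DirectProduct H) := hom_ext fun i x => by simp
  rw [← MonoidHom.id_apply _ x, ← h]
  exact lift_mem _ _ hx

/-- A family of pairwise commuting elements of pairwise coprime orders has product `1` only if it
is trivial. -/
theorem lift_injective_of_coprime (φ : ∀ i, H i →* G)
    (hφ : ∀ i j, i ≠ j → ∀ x y, Commute (φ i x) (φ j y))
    (hinj : ∀ i, Function.Injective (φ i))
    (hcop : ∀ i j, i ≠ j → ∀ (x : H i) (y : H j), (orderOf x).Coprime (orderOf y)) :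
    Function.Injective (lift φ hφ) := by
  classical
  rw [injective_iff_map_eq_one]
  intro x hx
  refine RestrictedProduct.ext _ _ fun i => ?_
  by_contra hi
  have hi' : i ∈ support x := by
    by_contra h
    exact hi (notMem_support.1 h)
  -- The power `n` kills every component except the one at `i`.
  set n := ∏ j ∈ (support x).erase i, orderOf (x j) with hn
  have h1 : x ^ n = single i (x i ^ n) := by
    refine RestrictedProduct.ext _ _ fun j => ?_
    by_cases hj : j = i
    · subst hj
      rw [RestrictedProduct.pow_apply, single_same]
    · rw [single_of_ne hj, RestrictedProduct.pow_apply]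
      by_cases hjs : j ∈ support x
      · rw [← orderOf_dvd_iff_pow_eq_one]
        exact Finset.dvd_prod_of_mem _ (Finset.mem_erase.2 ⟨hj, hjs⟩)
      · rw [notMem_support.1 hjs, one_pow]
  have h2 : x i ^ n = 1 := by
    apply hinj i
    rw [← lift_single φ hφ, ← h1, map_pow, hx, one_pow, map_one]
  have h3 : (orderOf (x i)).Coprime n :=
    Nat.Coprime.prod_right fun j hj => hcop i j (Finset.ne_of_mem_erase hj).symm _ _
  exact hi (orderOf_eq_one_iff.1 (Nat.Coprime.eq_one_of_dvd h3 (orderOf_dvd_of_pow_eq_one h2)))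

theorem mem_upperCentralSeries {c : ℕ} {x : DirectProduct H}
    (hx : ∀ i, x i ∈ Subgroup.upperCentralSeries (H i) c) :
    x ∈ Subgroup.upperCentralSeries (DirectProduct H) c := by
  induction c generalizing x with
  | zero => exact RestrictedProduct.ext _ _ hx
  | succ c ih => exact fun y => ih fun i => hx i (y i)

theorem mem_lowerCentralSeries {c : ℕ} {x : DirectProduct H}
    (hx : ∀ i, x i ∈ (⊤ : Subgroup (H i)).lowerCentralSeries c) :
    x ∈ (⊤ : Subgroup (DirectProduct H)).lowerCentralSeries c := by
  classical
  -- Finite support is essential: the tuple is a finite product of its components.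
  refine mem_of_forall_single_mem fun i => ?_
  have h := Subgroup.map_lowerCentralSeries (⊤ : Subgroup (H i))
    (single i : H i →* DirectProduct H) c
  exact Subgroup.lowerCentralSeries_mono c le_top (h ▸ Subgroup.mem_map_of_mem _ (hx i))

end DirectProduct

/-! ### Commutator calculus with the central series -/

namespace Subgroup

open scoped commutatorElement

variable {E : Type*} [Group E]

theorem commutator_le_iff_map_eq_bot {A B K : Subgroup E} [K.Normal] :
    ⁅A, B⁆ ≤ K ↔ ⁅A.map (QuotientGroup.mk' K), B.map (QuotientGroup.mk' K)⁆ = ⊥ := by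
  rw [← map_commutator, map_eq_bot_iff, QuotientGroup.ker_mk']

theorem commutator_le_iff_le_comap {A B K : Subgroup E} [K.Normal] :
    ⁅A, B⁆ ≤ K ↔
      A ≤ (centralizer (B.map (QuotientGroup.mk' K))).comap (QuotientGroup.mk' K) := by
  rw [commutator_le_iff_map_eq_bot, commutator_eq_bot_iff_le_centralizer, map_le_iff_le_comap]

theorem commutator_commutator_le_of_rotate {A B C K : Subgroup E} [K.Normal]
    (h₁ : ⁅⁅B, C⁆, A⁆ ≤ K) (h₂ : ⁅⁅C, A⁆, B⁆ ≤ K) : ⁅⁅A, B⁆, C⁆ ≤ K := by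
  rw [commutator_le_iff_map_eq_bot, map_commutator] at *
  exact commutator_commutator_eq_bot_of_rotate h₁ h₂

theorem iSup_commutator_le {ι : Type*} {A : ι → Subgroup E} {B K : Subgroup E} [K.Normal]
    (h : ∀ i, ⁅A i, B⁆ ≤ K) : ⁅⨆ i, A i, B⁆ ≤ K := by
  simp only [commutator_le_iff_le_comap] at *
  exact iSup_le h

theorem sup_commutator_le {A A' B K : Subgroup E} [K.Normal]
    (h : ⁅A, B⁆ ≤ K) (h' : ⁅A', B⁆ ≤ K) : ⁅A ⊔ A', B⁆ ≤ K := by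
  simp only [commutator_le_iff_le_comap] at *
  exact sup_le h h'

/-- Induction by the three subgroups lemma. The shift `n + 1` arises because index `n` stands for
$\gamma_{n+1}$. -/
theorem commutator_upperCentralSeries_lowerCentralSeries_le (n m : ℕ) :
    ⁅upperCentralSeries E (n + 1 + m), (⊤ : Subgroup E).lowerCentralSeries n⁆ ≤
      upperCentralSeries E m := by
  induction n generalizing m with
  | zero => rw [zero_add, add_comm]; exact commutator_upperCentralSeries_top_le E m
  | succ n ih =>
    rw [commutator_comm, lowerCentralSeries_succ]
    apply commutator_commutator_le_of_rotate
    · rw [commutator_comm ⊤]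
      refine (commutator_mono ?_ le_rfl).trans (ih m)
      rw [show n + 1 + 1 + m = n + 1 + m + 1 by omega]
      exact commutator_upperCentralSeries_top_le E _
    · refine (commutator_mono ?_ le_rfl).trans (commutator_upperCentralSeries_top_le E m)
      rw [show n + 1 + 1 + m = n + 1 + (m + 1) by omega]
      exact ih (m + 1)

/-- By the three subgroups lemma, each further commutation with `A` gains one step in the upper
central series. -/
theorem commutator_lowerCentralSeries_le {A B : Subgroup E} {n m : ℕ}
    (h : ⁅A, B⁆ ≤ upperCentralSeries E (n + m)) :
    ⁅A.lowerCentralSeries n, B⁆ ≤ upperCentralSeries E m := by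
  induction n generalizing m with
  | zero => simpa using h
  | succ n ih =>
    rw [lowerCentralSeries_succ]
    apply commutator_commutator_le_of_rotate
    · exact (commutator_mono h (lowerCentralSeries_mono n le_top)).trans
        (commutator_upperCentralSeries_lowerCentralSeries_le n m)
    · rw [commutator_comm B]
      refine (commutator_mono ?_ le_top).trans (commutator_upperCentralSeries_top_le E m)
      apply ih
      rwa [show n + (m + 1) = n + 1 + m by omega]

/-- Expanding commutators, the mixed terms and the central error terms all sink into $Z_m$. Each
commutation trades one step of `m` for one of `k`, so no error remains at `k = c + 1`. -/
theorem lowerCentralSeries_le_iSup_sup {ι : Type*} {A : ι → Subgroup E} [∀ i, (A i).Normal]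
    {c : ℕ} (htop : (⨆ i, A i) ⊔ upperCentralSeries E (c + 1) = ⊤)
    (hA : ∀ i j, i ≠ j → ⁅A i, A j⁆ ≤ upperCentralSeries E c) (k m : ℕ) (hkm : k + m = c + 1) :
    (⊤ : Subgroup E).lowerCentralSeries k ≤
      (⨆ i, (A i).lowerCentralSeries k) ⊔ upperCentralSeries E m := by
  have hn (i : ι) (k : ℕ) : ((A i).lowerCentralSeries k).Normal := by
    induction k with
    | zero => exact inferInstanceAs (A i).Normal
    | succ k ih => exact commutator_normal _ _
  have hn' (k : ℕ) : (⨆ i, (A i).lowerCentralSeries k).Normal :=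
    have := fun i => hn i k
    iSup_normal _
  induction k generalizing m with
  | zero =>
    obtain rfl : m = c + 1 := by omega
    simpa using htop.ge
  | succ k ih =>
    set K := (⨆ i, (A i).lowerCentralSeries (k + 1)) ⊔ upperCentralSeries E m with hK
    have hKn : K.Normal := sup_normal _ _
    have hZ : upperCentralSeries E m ≤ K := le_sup_right
    rw [lowerCentralSeries_succ]
    refine (commutator_mono (ih (m + 1) (by omega)) le_rfl).trans (sup_commutator_le ?_ ?_)
    · refine iSup_commutator_le fun i => ?_
      -- The whole group in the second argument is split into the `A j` and the central part.
      rw [← htop, commutator_comm]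
      refine sup_commutator_le (iSup_commutator_le fun j => ?_) ?_
      · rw [commutator_comm]
        by_cases hij : i = j
        · subst hij
          exact (le_iSup (fun i => (A i).lowerCentralSeries (k + 1)) i).trans le_sup_left
        · refine (commutator_lowerCentralSeries_le ?_).trans hZ
          rw [show k + m = c by omega]
          exact hA i j hij
      · refine le_trans ?_ hZ
        refine (commutator_mono le_rfl (lowerCentralSeries_mono k le_top)).trans ?_
        rw [show c + 1 = k + 1 + m by omega]
        exact commutator_upperCentralSeries_lowerCentralSeries_le k m
    · exact (commutator_upperCentralSeries_top_le E m).trans hZ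

theorem commutatorElement_mul_mul_of_commute {h z h' z' : E} (hz : ∀ x, Commute z x)
    (hz' : Commute h z') : ⁅h * z, h' * z'⁆ = ⁅h, h'⁆ := by
  have h1 : h * z = z * h := (hz h).eq.symm
  have h2 : ⁅h * z, h' * z'⁆ = h * (z * (h' * z') * z⁻¹) * h⁻¹ * (h' * z')⁻¹ := by
    rw [commutatorElement_def]
    group
  rw [h2, (hz _).eq, mul_inv_cancel_right, commutatorElement_def]
  have h3 : z' * h⁻¹ * z'⁻¹ = h⁻¹ := by
    rw [← (hz'.inv_left).eq, mul_inv_cancel_right]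
  calc h * (h' * z') * h⁻¹ * (h' * z')⁻¹ = h * h' * (z' * h⁻¹ * z'⁻¹) * h'⁻¹ := by group
    _ = _ := by rw [h3]

/-- `H` need not be normal, so the argument is elementwise. Modulo $Z_m$, `z` is central, while `z'`
is only known to commute with $\gamma_{k+1}(H)$, which is enough. -/
theorem lowerCentralSeries_sup_le {H : Subgroup E} {c : ℕ} (k m : ℕ) (hkm : k + m = c) :
    (H ⊔ upperCentralSeries E c).lowerCentralSeries k ≤
      H.lowerCentralSeries k ⊔ upperCentralSeries E m := by
  induction k generalizing m with
  | zero =>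
    obtain rfl : m = c := by omega
    simp
  | succ k ih =>
    rw [lowerCentralSeries_succ, commutator_le]
    intro g hg e he
    obtain ⟨h, hh, z, hz, rfl⟩ := mem_sup_of_normal_right.1 (ih (m + 1) (by omega) hg)
    obtain ⟨h', hh', z', hz', rfl⟩ := mem_sup_of_normal_right.1 he
    have key : (QuotientGroup.mk' (upperCentralSeries E m)) ⁅h * z, h' * z'⁆ =
        QuotientGroup.mk' (upperCentralSeries E m) ⁅h, h'⁆ := by
      simp only [map_commutatorElement, map_mul]
      apply commutatorElement_mul_mul_of_commute
      · intro x
        induction x using QuotientGroup.induction_on with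
        | H x =>
          rw [← commutatorElement_eq_one_iff_commute]
          exact (QuotientGroup.eq_one_iff _).2 (hz x)
      · refine Commute.symm ?_
        rw [← commutatorElement_eq_one_iff_commute]
        refine (QuotientGroup.eq_one_iff _).2 ?_
        refine commutator_upperCentralSeries_lowerCentralSeries_le k m ?_
        rw [show k + 1 + m = c by omega]
        exact commutator_mem_commutator hz' (lowerCentralSeries_mono k le_top hh)
    have := (QuotientGroup.eq (s := upperCentralSeries E m)).1 key.symm
    rw [mem_sup_of_normal_right]
    exact ⟨_, commutator_mem_commutator hh hh', _, this, by group⟩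

/-- Take `n`-th powers in $x=[x,y]\cdot yxy^{-1}$, where $[x,y]$ is central. -/
theorem pow_commutatorElement_eq_one {x y : E} {n : ℕ} (hu : ∀ z, Commute ⁅x, y⁆ z)
    (hn : Commute (x ^ n) y) : ⁅x, y⁆ ^ n = 1 := by
  have h1 : ⁅x, y⁆ * (y * x * y⁻¹) = x := by
    rw [commutatorElement_def]
    group
  have h2 : x ^ n = ⁅x, y⁆ ^ n * (y * x * y⁻¹) ^ n := by
    rw [← (hu _).mul_pow, h1]
  rwa [conj_pow, ← hn.eq, mul_inv_cancel_right, right_eq_mul] at h2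

theorem commute_of_coprime {x y : E} {n m : ℕ} (hnm : n.Coprime m) (hu : ∀ z, Commute ⁅x, y⁆ z)
    (hn : Commute (x ^ n) y) (hm : Commute x (y ^ m)) : Commute x y := by
  rw [← commutatorElement_eq_one_iff_commute]
  have h1 := pow_commutatorElement_eq_one hu hn
  have h2 : ⁅x, y⁆ ^ m = 1 := by
    rw [← inv_inj, ← inv_pow, commutatorElement_inv, inv_one]
    refine pow_commutatorElement_eq_one (fun z => ?_) hm.symm
    rw [← commutatorElement_inv]
    exact (hu z).inv_left
  have := Nat.dvd_gcd (orderOf_dvd_of_pow_eq_one h1) (orderOf_dvd_of_pow_eq_one h2)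
  rw [hnm] at this
  exact orderOf_eq_one_iff.1 (Nat.dvd_one.1 this)

/-! ### Extensions with kernel in the upper central series -/

section extension

variable {G : Type*} [Group G] {π : E →* G} {c : ℕ}
  (hker : π.ker ≤ upperCentralSeries E (c + 1))

include hker

theorem commutator_comap_le {P Q : Subgroup G} (hcomm : ∀ x ∈ P, ∀ y ∈ Q, Commute x y)
    (hcop : ∀ x ∈ P, ∀ y ∈ Q, (orderOf x).Coprime (orderOf y)) :
    ⁅P.comap π, Q.comap π⁆ ≤ upperCentralSeries E c := by
  rw [commutator_le]
  intro x hx y hy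
  rw [← QuotientGroup.eq_one_iff, ← QuotientGroup.mk'_apply, map_commutatorElement,
    commutatorElement_eq_one_iff_commute]
  have hcen : ∀ u ∈ π.ker, ∀ z, Commute (QuotientGroup.mk' (upperCentralSeries E c) u) z := by
    intro u hu z
    induction z using QuotientGroup.induction_on with
    | H z =>
      rw [← commutatorElement_eq_one_iff_commute]
      exact (QuotientGroup.eq_one_iff _).2 (hker hu z)
  refine commute_of_coprime (hcop _ hx _ hy) ?_ ?_ ?_
  · rw [← map_commutatorElement]
    refine hcen _ ?_
    rw [MonoidHom.mem_ker, map_commutatorElement, commutatorElement_eq_one_iff_commute]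
    exact hcomm _ hx _ hy
  · rw [← map_pow]
    exact hcen _ (by rw [MonoidHom.mem_ker, map_pow, pow_orderOf_eq_one]) _
  · rw [← map_pow]
    exact (hcen _ (by rw [MonoidHom.mem_ker, map_pow, pow_orderOf_eq_one]) _).symm

variable {ι : Type*} {P : ι → Subgroup G}
  (hcomm : ∀ i j, i ≠ j → ∀ x ∈ P i, ∀ y ∈ P j, Commute x y)
  (hcop : ∀ i j, i ≠ j → ∀ x ∈ P i, ∀ y ∈ P j, (orderOf x).Coprime (orderOf y))
  {H : ι → Subgroup E} (hH : ∀ i, (H i).map π = P i)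

include hcomm hcop hH

theorem commutator_lowerCentralSeries_of_coprime {i j : ι} (hij : i ≠ j) :
    ⁅(H i).lowerCentralSeries (c + 1), (H j).lowerCentralSeries (c + 1)⁆ = ⊥ := by
  have hle (i : ι) : H i ≤ (P i).comap π := map_le_iff_le_comap.1 (hH i).le
  rw [← le_bot_iff, ← upperCentralSeries_zero]
  refine (commutator_mono (lowerCentralSeries_antitone _ (Nat.le_succ c))
    (lowerCentralSeries_le_self _ _)).trans (commutator_lowerCentralSeries_le ?_)
  exact (commutator_mono (hle i) (hle j)).trans
    (commutator_comap_le hker (hcomm i j hij) (hcop i j hij))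

/-- The preimages of the `P i` are normal and generate; each exceeds `H i` only by elements of
$Z_{c+1}$, which do not affect $\gamma_{c+2}$. -/
theorem lowerCentralSeries_le_iSup_of_coprime [∀ i, (P i).Normal] (hπ : Function.Surjective π)
    (htop : ⨆ i, P i = ⊤) :
    (⊤ : Subgroup E).lowerCentralSeries (c + 1) ≤ ⨆ i, (H i).lowerCentralSeries (c + 1) := by
  have hP : (⨆ i, (P i).comap π) ⊔ upperCentralSeries E (c + 1) = ⊤ := by
    rw [eq_top_iff]
    refine le_trans ?_ (sup_le_sup_left hker _)
    rw [← comap_map_eq, map_iSup]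
    simp_rw [map_comap_eq_self_of_surjective hπ]
    rw [htop, comap_top]
  have h1 := lowerCentralSeries_le_iSup_sup hP
    (fun i j hij => commutator_comap_le hker (hcomm i j hij) (hcop i j hij)) (c + 1) 0 rfl
  rw [upperCentralSeries_zero, sup_bot_eq] at h1
  refine h1.trans (iSup_mono fun i => ?_)
  have h2 : (P i).comap π ≤ H i ⊔ upperCentralSeries E (c + 1) := by
    rw [← hH i, comap_map_eq]
    exact sup_le_sup_left hker _
  refine (lowerCentralSeries_mono _ h2).trans ?_
  simpa using lowerCentralSeries_sup_le (H := H i) (c := c + 1) (c + 1) 0 rfl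

end extension

end Subgroup

/-! ### Sylow subgroups of possibly infinite nilpotent groups -/

namespace Sylow

variable {G : Type*} [Group G]

theorem le_of_isPGroup_of_le_normalizer {p : ℕ} (P : Sylow p G) {Q : Subgroup G}
    (hQ : IsPGroup p Q) (h : Q ≤ Subgroup.normalizer (P : Set G)) : Q ≤ P := by
  rw [← P.is_maximal' (P.isPGroup'.to_sup_of_normal_left' hQ h) le_sup_left]
  exact le_sup_right

/-- By the normalizer condition it suffices that $N(P)$ is self-normalizing. An element normalizing
$N(P)$ conjugates `P` to a `p`-subgroup of $N(P)$, which lies in `P` by maximality. -/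
theorem normal_of_isNilpotent [Group.IsNilpotent G] {p : ℕ} (P : Sylow p G) :
    (P : Subgroup G).Normal := by
  refine Subgroup.normalizer_eq_top_iff.1 ?_
  refine normalizerCondition_iff_only_full_group_self_normalizing.1
    Group.normalizerCondition_of_isNilpotent _ (le_antisymm (fun g hg => ?_) Subgroup.le_normalizer)
  set N := Subgroup.normalizer ((P : Subgroup G) : Set G) with hN
  have key : ∀ g ∈ Subgroup.normalizer (N : Set G), ∀ x ∈ P, g * x * g⁻¹ ∈ P := by
    intro g hg x hx
    have hQ : IsPGroup p ((P : Subgroup G).map (MulAut.conj g).toMonoidHom) := P.isPGroup'.map _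
    refine P.le_of_isPGroup_of_le_normalizer hQ ?_ ⟨x, hx, rfl⟩
    rintro _ ⟨y, hy, rfl⟩
    exact (Subgroup.mem_normalizer_iff.1 hg y).1 (Subgroup.le_normalizer hy)
  rw [hN, Subgroup.mem_normalizer_iff]
  refine fun x => ⟨key g hg x, fun hx => ?_⟩
  have := key g⁻¹ (inv_mem hg) _ hx
  rw [inv_inv, ← mul_assoc, ← mul_assoc, inv_mul_cancel, one_mul, inv_mul_cancel_right] at this
  exact this

theorem mem_of_pow_prime_pow_eq_one [Group.IsNilpotent G] {p : ℕ} (P : Sylow p G) {x : G} {k : ℕ}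
    (hx : x ^ p ^ k = 1) : x ∈ P := by
  have := P.normal_of_isNilpotent
  refine P.le_of_isPGroup_of_le_normalizer (Q := Subgroup.zpowers x) ?_ ?_
    (Subgroup.mem_zpowers x)
  · rw [isPGroup_iff_pow_pow_eq_one]
    rintro ⟨_, n, rfl⟩
    refine ⟨k, Subtype.ext ?_⟩
    change (x ^ n) ^ p ^ k = 1
    rw [← zpow_natCast, zpow_comm, zpow_natCast, hx, one_zpow]
  · exact (Subgroup.normalizer_eq_top (P : Subgroup G)).symm ▸ le_top

end Sylow

section

variable {G : Type*} [Group G] {I : Type*} {p : I → ℕ} (hp : ∀ i, (p i).Prime)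
    (hp_inj : Function.Injective p) (P : ∀ i, Sylow (p i) G)

include hp hp_inj

theorem Sylow.coprime_orderOf {i j : I} (hij : i ≠ j) {x y : G} (hx : x ∈ P i) (hy : y ∈ P j) :
    (orderOf x).Coprime (orderOf y) := by
  have := Fact.mk (hp i)
  have := Fact.mk (hp j)
  obtain ⟨k, hk⟩ := IsPGroup.iff_orderOf.1 (P i).isPGroup' ⟨x, hx⟩
  obtain ⟨l, hl⟩ := IsPGroup.iff_orderOf.1 (P j).isPGroup' ⟨y, hy⟩
  rw [Subgroup.orderOf_mk] at hk hl
  rw [hk, hl]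
  exact Nat.Coprime.pow _ _ ((Nat.coprime_primes (hp i) (hp j)).2 fun h => hij (hp_inj h))

theorem Sylow.commute_of_isNilpotent [Group.IsNilpotent G] {i j : I} (hij : i ≠ j) {x y : G}
    (hx : x ∈ P i) (hy : y ∈ P j) : Commute x y := by
  refine Subgroup.commute_of_normal_of_disjoint _ _ (P i).normal_of_isNilpotent
    (P j).normal_of_isNilpotent ?_ x y hx hy
  rw [Subgroup.disjoint_def]
  intro z hz hz'
  have := Sylow.coprime_orderOf hp hp_inj P hij hz hz'
  rwa [Nat.coprime_self, orderOf_eq_one_iff] at this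

omit hp hp_inj

theorem Sylow.iSup_eq_top_of_isMulTorsion [Group.IsNilpotent G] (hG : IsMulTorsion G)
    (hp_all : ∀ q : ℕ, q.Prime → (∃ g : G, orderOf g = q) → ∃ i, p i = q) :
    ⨆ i, (P i : Subgroup G) = ⊤ := by
  have key : ∀ n : ℕ, 0 < n → ∀ x : G, x ^ n = 1 → x ∈ ⨆ i, (P i : Subgroup G) := by
    intro n
    induction n using Nat.recOnPosPrimePosCoprime with
    | zero => simp
    | one => simp +contextual [one_mem]
    | prime_pow q k hq hk =>
      intro _ x hx
      by_cases h1 : x = 1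
      · exact h1 ▸ one_mem _
      obtain ⟨j, -, hj⟩ := (Nat.dvd_prime_pow hq).1 (orderOf_dvd_of_pow_eq_one hx)
      have hj0 : j ≠ 0 := by
        rintro rfl
        exact h1 (by simpa using hj)
      -- If `x` has order $q^j$, then $x^{q^{j-1}}$ has order `q`, so `q` belongs to the family.
      obtain ⟨i, rfl⟩ := hp_all q hq ⟨x ^ q ^ (j - 1), by
        rw [orderOf_pow_of_dvd (pow_ne_zero _ hq.ne_zero) (hj ▸ pow_dvd_pow q (Nat.sub_le j 1)), hj,
          Nat.pow_div (Nat.sub_le j 1) hq.pos, Nat.sub_sub_self (by omega), pow_one]⟩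
      exact Subgroup.mem_iSup_of_mem i ((P i).mem_of_pow_prime_pow_eq_one hx)
    | coprime a b ha hb hab iha ihb =>
      intro _ x hx
      have h1 := ihb (by omega) (x ^ a) (by rwa [← pow_mul])
      have h2 := iha (by omega) (x ^ b) (by rwa [← pow_mul, mul_comm])
      have h3 : x = (x ^ a) ^ a.gcdA b * (x ^ b) ^ a.gcdB b := by
        rw [← zpow_natCast, ← zpow_natCast, ← zpow_mul, ← zpow_mul, ← zpow_add,
          ← Nat.gcd_eq_gcd_ab, hab, Nat.cast_one, zpow_one]
      rw [h3]
      exact mul_mem (zpow_mem h1 _) (zpow_mem h2 _)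
  exact eq_top_iff.2 fun x _ => key _ (hG x).orderOf_pos x (pow_orderOf_eq_one x)

end

/-! ### Internal direct decompositions -/

namespace DirectProduct

variable {G : Type*} [Group G] {I : Type*} {P : I → Subgroup G}
  (hcomm : ∀ i j, i ≠ j → ∀ x ∈ P i, ∀ y ∈ P j, Commute x y)
  (hcop : ∀ i j, i ≠ j → ∀ x ∈ P i, ∀ y ∈ P j, (orderOf x).Coprime (orderOf y))
  (htop : ⨆ i, P i = ⊤)

theorem iSup_range_le_range_lift {H : I → Type*} [∀ i, Group (H i)] (φ : ∀ i, H i →* G)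
    (hφ : ∀ i j, i ≠ j → ∀ x y, Commute (φ i x) (φ j y)) :
    ⨆ i, (φ i).range ≤ (lift φ hφ).range := by
  classical
  refine iSup_le fun i => ?_
  rintro _ ⟨x, rfl⟩
  exact ⟨single i x, lift_single φ hφ i x⟩

include hcop htop in
theorem lift_subtype_bijective :
    Function.Bijective (lift (H := fun i => P i) (fun i => (P i).subtype)
      fun i j hij x y => hcomm i j hij x x.2 y y.2) := by
  constructor
  · refine lift_injective_of_coprime _ _ (fun i => (P i).subtype_injective) ?_
    intro i j hij x y
    simpa using hcop i j hij x x.2 y y.2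
  · rw [← MonoidHom.range_eq_top, eq_top_iff, ← htop]
    refine le_trans ?_ (iSup_range_le_range_lift _ _)
    simp

/-- A group that is generated by pairwise commuting subgroups whose elements have pairwise coprime
orders is the direct product of these subgroups. -/
noncomputable def equivOfCoprime : DirectProduct (fun i => P i) ≃* G :=
  MulEquiv.ofBijective (lift (H := fun i => P i) (fun i => (P i).subtype)
    fun i j hij x y => hcomm i j hij x x.2 y y.2) (lift_subtype_bijective hcomm hcop htop)

theorem equivOfCoprime_single [DecidableEq I] (i : I) (x : P i) :
    equivOfCoprime hcomm hcop htop (single i x) = x :=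
  lift_single (H := fun i => P i) (fun i => (P i).subtype)
    (fun i j hij x y => hcomm i j hij x x.2 y y.2) i x

end DirectProduct

/-! ### Iterated commutators -/

theorem iteratedCommutator_le_self {F : Type*} [Group F] (R : Subgroup F) [R.Normal] (c : ℕ) :
    iteratedCommutator R c ≤ R := by
  induction c with
  | zero => exact le_rfl
  | succ c ih => exact (Subgroup.commutator_le_left _ _).trans ih

theorem iteratedCommutator_mono {F : Type*} [Group F] {R S : Subgroup F} (h : R ≤ S) (c : ℕ) :
    iteratedCommutator R c ≤ iteratedCommutator S c := by
  induction c with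
  | zero => exact h
  | succ c ih => exact Subgroup.commutator_mono ih le_rfl

theorem map_iteratedCommutator_le {F F' : Type*} [Group F] [Group F'] (f : F →* F')
    (R : Subgroup F) (c : ℕ) :
    (iteratedCommutator R c).map f ≤ iteratedCommutator (R.map f) c := by
  induction c with
  | zero => exact le_rfl
  | succ c ih =>
    rw [iteratedCommutator, Subgroup.map_commutator]
    exact Subgroup.commutator_mono ih le_top

theorem map_iteratedCommutator_of_surjective {F F' : Type*} [Group F] [Group F'] {f : F →* F'}
    (hf : Function.Surjective f) (R : Subgroup F) (c : ℕ) :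
    (iteratedCommutator R c).map f = iteratedCommutator (R.map f) c := by
  induction c with
  | zero => rfl
  | succ c ih =>
    rw [iteratedCommutator, iteratedCommutator, Subgroup.map_commutator, ih,
      Subgroup.map_top_of_surjective f hf]

theorem le_upperCentralSeries_of_iteratedCommutator_le {F : Type*} [Group F] {R : Subgroup F}
    (c m : ℕ) (h : iteratedCommutator R c ≤ Subgroup.upperCentralSeries F m) :
    R ≤ Subgroup.upperCentralSeries F (c + m) := by
  induction c generalizing m with
  | zero => rw [zero_add]; exact h
  | succ c ih =>
    rw [Nat.succ_add_eq_add_succ]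
    exact ih (m + 1) fun x hx y =>
      h (Subgroup.commutator_mem_commutator hx (Subgroup.mem_top y))

namespace DirectProduct

/-- The projection of a direct product onto a factor. -/
def eval {ι : Type*} {H : ι → Type*} [∀ i, Group (H i)] (i : ι) : DirectProduct H →* H i where
  toFun x := x i
  map_one' := rfl
  map_mul' _ _ := rfl

@[simp]
theorem eval_apply {ι : Type*} {H : ι → Type*} [∀ i, Group (H i)] (i : ι) (x : DirectProduct H) :
    eval i x = x i := rfl

end DirectProduct

/-! ### Functoriality of the multiplier -/

namespace NilpotentMultiplier

variable {G H K : Type*} [Group G] [Group H] [Group K] (c : ℕ)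

theorem lift_map (f : G →* H) (w : FreeGroup G) :
    FreeGroup.lift id (FreeGroup.map f w) = f (FreeGroup.lift id w) :=
  DFunLike.congr_fun (f := (FreeGroup.lift id).comp (FreeGroup.map f))
    (g := f.comp (FreeGroup.lift id)) (by ext; simp) w

theorem map_presentationKernel_le (f : G →* H) :
    (presentationKernel G).map (FreeGroup.map f) ≤ presentationKernel H := by
  rintro _ ⟨w, hw, rfl⟩
  have hw : FreeGroup.lift id w = 1 := hw
  rw [presentationKernel, MonoidHom.mem_ker, lift_map, hw, map_one]

theorem map_mem_lowerCentralSeries (f : G →* H) {w : G}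
    (hw : w ∈ (⊤ : Subgroup G).lowerCentralSeries c) :
    f w ∈ (⊤ : Subgroup H).lowerCentralSeries c := by
  have h := Subgroup.map_lowerCentralSeries (⊤ : Subgroup G) f c
  exact Subgroup.lowerCentralSeries_mono c le_top (h ▸ Subgroup.mem_map_of_mem _ hw)

/-- The homomorphism between the numerators of the multipliers that is induced by a
homomorphism. -/
def numeratorMap (f : G →* H) : multiplierNumerator c G →* multiplierNumerator c H :=
  ((FreeGroup.map f).comp (multiplierNumerator c G).subtype).codRestrict _ fun w =>
    ⟨map_presentationKernel_le f (Subgroup.mem_map_of_mem _ w.2.1),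
      map_mem_lowerCentralSeries c (FreeGroup.map f) w.2.2⟩

/-- The homomorphism between the multipliers that is induced by a homomorphism. -/
def map (f : G →* H) : NilpotentMultiplier c G →* NilpotentMultiplier c H :=
  QuotientGroup.map _ _ (numeratorMap c f) fun _ hw =>
    iteratedCommutator_mono (map_presentationKernel_le f) c
      (map_iteratedCommutator_le _ _ c (Subgroup.mem_map_of_mem _ hw))

theorem map_mk (f : G →* H) (w : multiplierNumerator c G) :
    map c f (QuotientGroup.mk w) = QuotientGroup.mk (numeratorMap c f w) := rfl

theorem map_map (f : G →* H) (g : H →* K) (x : NilpotentMultiplier c G) :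
    map c g (map c f x) = map c (g.comp f) x := by
  induction x using QuotientGroup.induction_on with
  | H w =>
    rw [map_mk, map_mk, map_mk]
    refine congrArg _ (Subtype.ext ?_)
    exact FreeGroup.map.comp _ _ _

theorem map_id (x : NilpotentMultiplier c G) : map c (MonoidHom.id G) x = x := by
  induction x using QuotientGroup.induction_on with
  | H w =>
    rw [map_mk]
    refine congrArg _ (Subtype.ext ?_)
    exact FreeGroup.map.id _

instance subsingleton_zero : Subsingleton (NilpotentMultiplier 0 G) := by
  refine ⟨fun x y => ?_⟩
  have h (x : NilpotentMultiplier 0 G) : x = 1 := by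
    induction x using QuotientGroup.induction_on with
    | H w => exact (QuotientGroup.eq_one_iff w).2 w.2.1
  rw [h x, h y]

/-- The induced map of free groups is not trivial: all generators go to the generator `of 1`. It
factors through the exponent sum into $\mathbb Z$, hence kills $\gamma_2$, which contains the
numerator once $c\ge1$. -/
theorem map_one_hom (x : NilpotentMultiplier c G) : map c (1 : G →* H) x = 1 := by
  cases c with
  | zero => exact Subsingleton.elim _ _
  | succ c =>
    induction x using QuotientGroup.induction_on with
    | H w =>
      rw [map_mk, show numeratorMap (c + 1) (1 : G →* H) w = 1 from Subtype.ext ?_]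
      · exact QuotientGroup.mk_one _
      set d : FreeGroup G →* Multiplicative ℤ := FreeGroup.lift fun _ => Multiplicative.ofAdd 1
      have h : FreeGroup.map (1 : G →* H) =
          (zpowersHom (FreeGroup H) (FreeGroup.of 1)).comp d := by
        ext x
        simp [d]
      change FreeGroup.map (1 : G →* H) (w : FreeGroup G) = 1
      have hw : (w : FreeGroup G) ∈ commutator (FreeGroup G) :=
        Subgroup.lowerCentralSeries_antitone _ (Nat.le_add_left 1 c) w.2.2
      rw [h, MonoidHom.comp_apply,
        show d w = 1 from Abelianization.commutator_subset_ker d hw, map_one]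

/-! ### The cover $F/[R,{}_cF]$ -/

/-- The quotient of the free group on `G` by the denominator of the multiplier. -/
abbrev Cover (G : Type*) [Group G] : Type _ :=
  FreeGroup G ⧸ iteratedCommutator (presentationKernel G) c

namespace Cover

/-- The canonical homomorphism from the cover to the group. -/
def proj : Cover c G →* G :=
  QuotientGroup.lift _ (FreeGroup.lift id) fun _ hw =>
    iteratedCommutator_le_self (presentationKernel G) c hw

theorem proj_mk (w : FreeGroup G) : proj c (QuotientGroup.mk w) = FreeGroup.lift id w := rfl

theorem proj_surjective : Function.Surjective (proj c (G := G)) := fun g =>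
  ⟨QuotientGroup.mk (FreeGroup.of g), by simp [proj_mk]⟩

theorem ker_proj_le : (proj c (G := G)).ker ≤ Subgroup.upperCentralSeries (Cover c G) c := by
  have h : (proj c (G := G)).ker ≤ (presentationKernel G).map
      (QuotientGroup.mk' (iteratedCommutator (presentationKernel G) c)) := by
    intro x hx
    induction x using QuotientGroup.induction_on with
    | H w => exact ⟨w, hx, rfl⟩
  refine h.trans (le_upperCentralSeries_of_iteratedCommutator_le c 0 ?_)
  rw [← map_iteratedCommutator_of_surjective (QuotientGroup.mk'_surjective _),
    Subgroup.upperCentralSeries_zero, le_bot_iff, Subgroup.map_eq_bot_iff, QuotientGroup.ker_mk']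

end Cover

/-- The inclusion of the multiplier into the cover. -/
def toCover : NilpotentMultiplier c G →* Cover c G :=
  QuotientGroup.map _ _ (multiplierNumerator c G).subtype fun _ hw => hw

theorem toCover_mk (w : multiplierNumerator c G) :
    toCover c (QuotientGroup.mk w) = QuotientGroup.mk (w : FreeGroup G) := rfl

theorem toCover_injective : Function.Injective (toCover c (G := G)) := by
  rw [injective_iff_map_eq_one]
  intro x hx
  induction x using QuotientGroup.induction_on with
  | H w =>
    rw [toCover_mk, QuotientGroup.eq_one_iff] at hx
    exact (QuotientGroup.eq_one_iff w).2 hx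

/-! ### Multipliers of coprime decompositions -/

section coprime

variable {I : Type*} {P : I → Subgroup G}
  (hcomm : ∀ i j, i ≠ j → ∀ x ∈ P i, ∀ y ∈ P j, Commute x y)
  (hcop : ∀ i j, i ≠ j → ∀ x ∈ P i, ∀ y ∈ P j, (orderOf x).Coprime (orderOf y))
  (htop : ⨆ i, P i = ⊤)

/-- The homomorphism from the free group on a subgroup to the cover. -/
def freeToCover (P : Subgroup G) : FreeGroup P →* Cover c G :=
  (QuotientGroup.mk' _).comp (FreeGroup.map P.subtype)

theorem proj_freeToCover (P : Subgroup G) (w : FreeGroup P) :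
    Cover.proj c (freeToCover c P w) = (FreeGroup.lift id w : P) :=
  lift_map P.subtype w

theorem map_proj_range_freeToCover (P : Subgroup G) :
    (freeToCover c P).range.map (Cover.proj c) = P := by
  ext x
  constructor
  · rintro ⟨_, ⟨w, rfl⟩, rfl⟩
    rw [proj_freeToCover]
    exact SetLike.coe_mem _
  · intro hx
    refine ⟨_, ⟨FreeGroup.of ⟨x, hx⟩, rfl⟩, ?_⟩
    rw [proj_freeToCover]
    simp

/-- The restriction of `freeToCover` to a term of the lower central series. -/
def lowerToCover (P : Subgroup G) :
    (⊤ : Subgroup (FreeGroup P)).lowerCentralSeries c →* Cover c G :=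
  (freeToCover c P).comp (Subgroup.subtype _)

theorem range_lowerToCover (P : Subgroup G) :
    (lowerToCover c P).range = (freeToCover c P).range.lowerCentralSeries c := by
  rw [lowerToCover, MonoidHom.range_comp, Subgroup.range_subtype, Subgroup.map_lowerCentralSeries,
    MonoidHom.range_eq_map]

theorem toCover_map_subtype (P : Subgroup G) (w : multiplierNumerator c P) :
    toCover c (map c P.subtype (QuotientGroup.mk w)) =
      lowerToCover c P (Subgroup.inclusion inf_le_right w) := rfl

include hcomm hcop in
theorem commute_lowerToCover {i j : I} (hij : i ≠ j)
    (x : (⊤ : Subgroup (FreeGroup (P i))).lowerCentralSeries (c + 1))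
    (y : (⊤ : Subgroup (FreeGroup (P j))).lowerCentralSeries (c + 1)) :
    Commute (lowerToCover (c + 1) (P i) x) (lowerToCover (c + 1) (P j) y) := by
  have h := Subgroup.commutator_lowerCentralSeries_of_coprime (Cover.ker_proj_le (c + 1))
    hcomm hcop (fun i => map_proj_range_freeToCover (c + 1) (P i)) hij
  rw [← range_lowerToCover, ← range_lowerToCover,
    Subgroup.commutator_eq_bot_iff_le_centralizer] at h
  exact (Subgroup.mem_centralizer_iff.1 (h ⟨x, rfl⟩) _ ⟨y, rfl⟩).symm

include hcomm hcop in
theorem commute_map_subtype {i j : I} (hij : i ≠ j) (x : NilpotentMultiplier c (P i))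
    (y : NilpotentMultiplier c (P j)) :
    Commute (map c (P i).subtype x) (map c (P j).subtype y) := by
  cases c with
  | zero => exact Subsingleton.elim _ _
  | succ c =>
    induction x using QuotientGroup.induction_on with
    | H x =>
      induction y using QuotientGroup.induction_on with
      | H y =>
        apply toCover_injective
        rw [_root_.map_mul, _root_.map_mul, toCover_map_subtype, toCover_map_subtype]
        exact commute_lowerToCover c hcomm hcop hij _ _

/-- The canonical homomorphism from the direct product of the multipliers of pairwise commuting
subgroups of coprime orders to the multiplier of the group. -/
noncomputable def liftSubtype :
    DirectProduct (fun i => NilpotentMultiplier c (P i)) →* NilpotentMultiplier c G :=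
  DirectProduct.lift (fun i => map c (P i).subtype) fun _ _ hij =>
    commute_map_subtype c hcomm hcop hij

include htop in
theorem liftSubtype_injective : Function.Injective (liftSubtype c hcomm hcop) := by
  classical
  rw [injective_iff_map_eq_one]
  intro x hx
  refine RestrictedProduct.ext _ _ fun i => ?_
  -- The projection onto `P i`: identity on `P i`, trivial on the other `P k`, so it recovers the
  -- component at `i`.
  let π : G →* P i := (DirectProduct.eval i).comp
    (DirectProduct.equivOfCoprime hcomm hcop htop).symm.toMonoidHom
  have hπ (k : I) (y : P k) : π y = DirectProduct.single (H := fun i => P i) k y i := by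
    change (DirectProduct.equivOfCoprime hcomm hcop htop).symm y i = _
    rw [← DirectProduct.equivOfCoprime_single hcomm hcop htop, MulEquiv.symm_apply_apply]
  have h : (map c π).comp (liftSubtype c hcomm hcop) = DirectProduct.eval i :=
    DirectProduct.hom_ext fun k y => by
      rw [MonoidHom.comp_apply, liftSubtype, DirectProduct.lift_single, map_map,
        DirectProduct.eval_apply]
      by_cases hik : i = k
      · subst hik
        rw [DirectProduct.single_same,
          show π.comp (P i).subtype = MonoidHom.id _ from
            MonoidHom.ext fun y =>
              (hπ i y).trans (DirectProduct.single_same (H := fun i => P i) i y), map_id]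
      · rw [DirectProduct.single_of_ne hik,
          show π.comp (P k).subtype = 1 from
            MonoidHom.ext fun y =>
              (hπ k y).trans (DirectProduct.single_of_ne (H := fun i => P i) hik y), map_one_hom]
  rw [← DirectProduct.eval_apply, ← h, MonoidHom.comp_apply, hx, _root_.map_one]
  rfl

include htop in
theorem liftSubtype_surjective [∀ i, (P i).Normal] :
    Function.Surjective (liftSubtype c hcomm hcop) := by
  classical
  cases c with
  | zero => exact fun x => ⟨1, Subsingleton.elim _ _⟩
  | succ c =>
    intro x
    induction x using QuotientGroup.induction_on with
    | H w =>
      have hψ (i j : I) (hij : i ≠ j) := commute_lowerToCover c hcomm hcop hij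
      have hw : (QuotientGroup.mk (w : FreeGroup G) : Cover (c + 1) G) ∈
          (DirectProduct.lift (fun i => lowerToCover (c + 1) (P i)) hψ).range := by
        refine DirectProduct.iSup_range_le_range_lift _ _ ?_
        simp_rw [range_lowerToCover]
        exact Subgroup.lowerCentralSeries_le_iSup_of_coprime (Cover.ker_proj_le (c + 1)) hcomm hcop
          (fun i => map_proj_range_freeToCover (c + 1) (P i)) (Cover.proj_surjective (c + 1)) htop
          (map_mem_lowerCentralSeries (c + 1) (QuotientGroup.mk' _) w.2.2)
      obtain ⟨u, hu⟩ := hw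
      let ρ (i : I) : (⊤ : Subgroup (FreeGroup (P i))).lowerCentralSeries (c + 1) →* P i :=
        (FreeGroup.lift id).comp (Subgroup.subtype _)
      have hρ : (Cover.proj (c + 1)).comp
          (DirectProduct.lift (fun i => lowerToCover (c + 1) (P i)) hψ) =
          (DirectProduct.equivOfCoprime hcomm hcop htop).toMonoidHom.comp
            (DirectProduct.map ρ) :=
        DirectProduct.hom_ext fun i y => by
          have hs : DirectProduct.map ρ (DirectProduct.single i y) =
              DirectProduct.single i (ρ i y) := DirectProduct.map_single _ _ _
          rw [MonoidHom.comp_apply, MonoidHom.comp_apply, DirectProduct.lift_single, hs]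
          exact (proj_freeToCover (c + 1) (P i) y).trans
            (DirectProduct.equivOfCoprime_single hcomm hcop htop i (ρ i y)).symm
      -- `w` is a relation, so `u` maps to `1` in `G`; by uniqueness of components each `u i` is a
      -- relation of `P i`, hence in the numerator.
      have hu1 : u ∈ (DirectProduct.map ρ).ker := by
        have h := DFunLike.congr_fun hρ u
        rw [MonoidHom.comp_apply, hu, Cover.proj_mk, show FreeGroup.lift id (w : FreeGroup G) = 1
          from w.2.1] at h
        exact (map_eq_one_iff _ (DirectProduct.equivOfCoprime hcomm hcop htop).injective).1 h.symm
      let incl (i : I) : multiplierNumerator (c + 1) (P i) →*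
          (⊤ : Subgroup (FreeGroup (P i))).lowerCentralSeries (c + 1) :=
        Subgroup.inclusion inf_le_right
      obtain ⟨v, rfl⟩ : u ∈ (DirectProduct.map incl).range :=
        DirectProduct.mem_range_map.2 fun i =>
          ⟨⟨u i, DirectProduct.mem_ker_map.1 hu1 i, (u i).2⟩, rfl⟩
      have h : ((toCover (c + 1)).comp (liftSubtype (c + 1) hcomm hcop)).comp
          (DirectProduct.map fun i => QuotientGroup.mk' _) =
          (DirectProduct.lift (fun i => lowerToCover (c + 1) (P i)) hψ).comp
            (DirectProduct.map incl) :=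
        DirectProduct.hom_ext fun i y => by
          rw [MonoidHom.comp_apply, MonoidHom.comp_apply, MonoidHom.comp_apply,
            DirectProduct.map_single, DirectProduct.map_single, liftSubtype,
            DirectProduct.lift_single, DirectProduct.lift_single]
          rfl
      exact ⟨_, toCover_injective (c + 1) ((DFunLike.congr_fun h v).trans hu)⟩

/-- The multiplier of the direct product of a family of groups whose elements have pairwise coprime
orders is the direct product of the multipliers. -/
noncomputable def directProductEquiv [∀ i, (P i).Normal] :
    DirectProduct (fun i => NilpotentMultiplier c (P i)) ≃* NilpotentMultiplier c G :=
  MulEquiv.ofBijective (liftSubtype c hcomm hcop)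
    ⟨liftSubtype_injective c hcomm hcop htop, liftSubtype_surjective c hcomm hcop htop⟩

end coprime

end NilpotentMultiplier

/-! ### Assembly of the covering group -/

theorem corollary4p3 (c : ℕ) {G : Type*} [Group G] [Group.IsNilpotent G]
    (hG : IsMulTorsion G) {I : Type*} (p : I → ℕ) (hp : ∀ i, (p i).Prime)
    (hp_inj : Function.Injective p)
    (hp_all : ∀ q : ℕ, q.Prime → (∃ g : G, orderOf g = q) → ∃ i, p i = q)
    (P : ∀ i, Sylow (p i) G)
    (Ps : I → Type*) [∀ i, Group (Ps i)]
    (hPs : ∀ i, IsNilpotentCovering c (P i) (Ps i)) :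
    IsNilpotentCovering c G (DirectProduct Ps) := by
  let S (i : I) : Subgroup G := P i
  have hS (i : I) : (S i).Normal := (P i).normal_of_isNilpotent
  have hcomm (i j : I) (hij : i ≠ j) (x : G) (hx : x ∈ S i) (y : G) (hy : y ∈ S j) :
      Commute x y := Sylow.commute_of_isNilpotent hp hp_inj P hij hx hy
  have hcop (i j : I) (hij : i ≠ j) (x : G) (hx : x ∈ S i) (y : G) (hy : y ∈ S j) :
      (orderOf x).Coprime (orderOf y) := Sylow.coprime_orderOf hp hp_inj P hij hx hy
  have htop : ⨆ i, S i = ⊤ := Sylow.iSup_eq_top_of_isMulTorsion P hG hp_all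
  choose A hn hA hq hm using hPs
  let q (i : I) : Ps i →* S i := (hq i).some.toMonoidHom.comp (QuotientGroup.mk' (A i))
  have hq_ker (i : I) : (q i).ker = A i := by
    ext x
    exact (map_eq_one_iff _ (hq i).some.injective).trans (QuotientGroup.eq_one_iff x)
  have hq_surj (i : I) : Function.Surjective (q i) :=
    (hq i).some.surjective.comp (QuotientGroup.mk'_surjective _)
  let α (i : I) : NilpotentMultiplier c (S i) →* Ps i :=
    (A i).subtype.comp (hm i).some.symm.toMonoidHom
  have hα (i : I) : Function.Injective (α i) :=
    (A i).subtype_injective.comp (hm i).some.symm.injective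
  have hα_range (i : I) : (α i).range = A i := by
    ext x
    exact ⟨fun ⟨y, hy⟩ => hy ▸ SetLike.coe_mem _, fun hx => ⟨(hm i).some ⟨x, hx⟩,
      congrArg Subtype.val ((hm i).some.symm_apply_apply _)⟩⟩
  -- As a kernel this subgroup has the right quotient; as a range it is a copy of the product of the
  -- multipliers.
  have hker : (DirectProduct.map q).ker = (DirectProduct.map α).range := by
    ext x
    rw [DirectProduct.mem_ker_map, DirectProduct.mem_range_map]
    simp only [hq_ker, hα_range]
  refine ⟨(DirectProduct.map q).ker, inferInstance, fun x hx => ?_, ⟨?_⟩, ⟨?_⟩⟩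
  · have hx (i : I) := hA i (hq_ker i ▸ DirectProduct.mem_ker_map.1 hx i)
    exact ⟨DirectProduct.mem_upperCentralSeries fun i => (hx i).1,
      DirectProduct.mem_lowerCentralSeries fun i => (hx i).2⟩
  · exact (QuotientGroup.quotientKerEquivOfSurjective _
      (DirectProduct.map_surjective hq_surj)).trans
      (DirectProduct.equivOfCoprime hcomm hcop htop)
  · exact ((MulEquiv.subgroupCongr hker).trans
      (MonoidHom.ofInjective (DirectProduct.map_injective hα)).symm).trans
      (NilpotentMultiplier.directProductEquiv c hcomm hcop htop)
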